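/- For $L\in SL(2,\mathbb Z)$ let $M_L$ be the torus bundle over the circle with monodromy $L$, that is, the mapping torus of the linear self-homeomorphism $x\mapsto Lx$ of $T^2=\mathbb R^2/\mathbb Z^2$: the quotient of $T^2\times\mathbb R$ by the equivalence relation generated by $(x,t+1)\sim(Lx,t)$. Let $A,B\in SL(2,\mathbb Z)$ satisfy $|\operatorname{trace}(A)|\ge 3$ and $|\operatorname{trace}(B)|\ge 3$, so that $M_A$ and $M_B$ are the solvmanifolds with monodromies $A$ and $B$. Then the following are equivalent: 1. $M_A$ has a finite cover homeomorphic to $M_B$, and $M_B$ has a finite cover homeomorphic to $M_A$; 2. $\operatorname{trace}(A)=\operatorname{trace}(B)$. -/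

import Mathlib

/-- The two points `p` and `q` of `X × ℝ` are identified in the mapping torus of `f`:
`q = (f ^ n (x), t - n)` for some integer `n`, where `p = (x, t)`. This is the equivalence
relation generated by `(x, t + 1) ∼ (f x, t)`; on `X × [0, 1]` it is `(x, 1) ∼ (f x, 0)`. -/
def mappingTorusSetoid {X : Type*} [TopologicalSpace X] (f : X ≃ₜ X) : Setoid (X × ℝ) where
  r p q := ∃ n : ℤ, q = ((f ^ n) p.1, p.2 - n)
  iseqv :=
    { refl := fun p => ⟨0, by simp⟩
      symm := by
        rintro p q ⟨n, rfl⟩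
        refine ⟨-n, ?_⟩
        ext
        · change p.1 = (f ^ (-n) * f ^ n) p.1
          rw [← zpow_add]; simp
        · simp
      trans := by
        rintro p q r ⟨n, rfl⟩ ⟨m, rfl⟩
        refine ⟨m + n, ?_⟩
        ext
        · change (f ^ m * f ^ n) p.1 = _
          rw [← zpow_add]
        · simp; ring }

/-- The mapping torus of a self-homeomorphism `f` of `X`, with the quotient topology. It is the
`X`-bundle over the circle with monodromy `f`. -/
def MappingTorus {X : Type*} [TopologicalSpace X] (f : X ≃ₜ X) : Type _ :=
  Quotient (mappingTorusSetoid f)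

instance {X : Type*} [TopologicalSpace X] (f : X ≃ₜ X) : TopologicalSpace (MappingTorus f) :=
  inferInstanceAs (TopologicalSpace (Quotient (mappingTorusSetoid f)))

/-- The self-map `x ↦ L x` of the torus `(ℝ / ℤ) × (ℝ / ℤ)` induced by an integer matrix `L`. -/
def torusMatrixMap (L : Matrix (Fin 2) (Fin 2) ℤ) (x : UnitAddTorus (Fin 2)) : UnitAddTorus (Fin 2) :=
  fun i => ∑ j, L i j • x j

theorem torusMatrixMap_one (x : UnitAddTorus (Fin 2)) : torusMatrixMap 1 x = x := by
  funext i
  simp [torusMatrixMap, Matrix.one_apply, ite_smul]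

theorem torusMatrixMap_mul (K L : Matrix (Fin 2) (Fin 2) ℤ) (x : UnitAddTorus (Fin 2)) :
    torusMatrixMap (K * L) x = torusMatrixMap K (torusMatrixMap L x) := by
  funext i
  simp only [torusMatrixMap, Matrix.mul_apply, Fin.sum_univ_two, add_smul, smul_add, mul_smul]
  abel

theorem continuous_torusMatrixMap (L : Matrix (Fin 2) (Fin 2) ℤ) : Continuous (torusMatrixMap L) := by
  unfold torusMatrixMap
  fun_prop

/-- The linear self-homeomorphism of the torus given by a matrix in `SL(2, ℤ)`. -/
def torusHomeo (L : Matrix.SpecialLinearGroup (Fin 2) ℤ) :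
    UnitAddTorus (Fin 2) ≃ₜ UnitAddTorus (Fin 2) where
  toFun := torusMatrixMap L.1
  invFun := torusMatrixMap (L⁻¹).1
  left_inv x := by
    rw [← torusMatrixMap_mul, ← Matrix.SpecialLinearGroup.coe_mul, inv_mul_cancel,
      Matrix.SpecialLinearGroup.coe_one, torusMatrixMap_one]
  right_inv x := by
    rw [← torusMatrixMap_mul, ← Matrix.SpecialLinearGroup.coe_mul, mul_inv_cancel,
      Matrix.SpecialLinearGroup.coe_one, torusMatrixMap_one]
  continuous_toFun := continuous_torusMatrixMap L.1
  continuous_invFun := continuous_torusMatrixMap (L⁻¹).1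

/-- The torus bundle `M_L` over the circle with monodromy `L`. It is a solvmanifold when
`|trace L| > 2`. -/
def TorusBundle (L : Matrix.SpecialLinearGroup (Fin 2) ℤ) : Type :=
  MappingTorus (torusHomeo L)

instance (L : Matrix.SpecialLinearGroup (Fin 2) ℤ) : TopologicalSpace (TorusBundle L) :=
  inferInstanceAs (TopologicalSpace (MappingTorus (torusHomeo L)))

/-- `p : E → X` is a finite covering: a surjective covering map with finite fibers. -/
structure IsFiniteCovering {E X : Type*} [TopologicalSpace E] [TopologicalSpace X]
    (p : E → X) : Prop where
  isCoveringMap : IsCoveringMap p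
  surjective : Function.Surjective p
  finite_fiber : ∀ x, (p ⁻¹' {x}).Finite

/-- Some finite cover `E` of `X` is homeomorphic to `Y`. -/
def HasFiniteCoverHomeomorphicTo (X Y : Type) [TopologicalSpace X] [TopologicalSpace Y] : Prop :=
  ∃ (E : Type) (_ : TopologicalSpace E) (p : E → X), IsFiniteCovering p ∧ Nonempty (E ≃ₜ Y)

/-!
The group `ℤ² ⋊_L ℤ` acts freely and properly on `ℝ² × ℝ` with quotient `M_L`
(`isQuotientCoveringMap_torusBundleProj`), so it is the fundamental group of `M_L`.

If `M_B` covers `M_A`, then `ℤ² ⋊_B ℤ` embeds in `ℤ² ⋊_A ℤ`. The lattice `(B - 1) ℤ²` consists of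
commutators, hence lands in the fiber subgroup `ℤ²` of the target, and the embedding yields an
integer matrix `P` with `det P ≠ 0` and `P B = Aⁿ P` for some `n : ℤ`
(`TorusBundleGroup.exists_intertwiner_of_injective`). Therefore `tr B = tr Aⁿ`. If moreover `M_A`
covers `M_B`, then `tr A = tr Bᵐ` for some `m : ℤ`. As `tr A⁻¹ = tr A` and `|tr Aᵏ|` is strictly
increasing in `k : ℕ` when `|tr A| ≥ 3`, both exponents are `±1` and the traces agree
(`trace_eq_of_trace_eq_zpow`).

Conversely, if the traces agree, then `A` and `B` are conjugate over `ℚ`, so `A P = P B` for an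
integer matrix `P` with `det P ≠ 0` (`exists_intertwiner`), and `(x, t) ↦ (P x, t)` induces a
finite covering `M_B → M_A` (`exists_isFiniteCovering`).
-/

open Matrix Topology

/-! ### Covering maps and mapping tori -/

/-- A covering map between spaces with simply connected covers embeds the deck group of the source
in that of the target: deck groups are (opposites of) fundamental groups, and a covering map is
injective on these. -/
theorem IsQuotientCoveringMap.exists_injective_monoidHom {E X E' Y G H : Type*}
    [TopologicalSpace E] [TopologicalSpace X] [TopologicalSpace E'] [TopologicalSpace Y]
    [Group G] [MulAction G E] [Group H] [MulAction H E'] [SimplyConnectedSpace E]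
    [SimplyConnectedSpace E'] {p : E → X} {p' : E' → Y} (hp : IsQuotientCoveringMap p G)
    (hp' : IsQuotientCoveringMap p' H) {q : Y → X} (hq : IsCoveringMap q) :
    ∃ ρ : H →* G, Function.Injective ρ := by
  obtain ⟨e'⟩ : Nonempty E' := inferInstance
  obtain ⟨e, he⟩ := hp.surjective (q (p' e'))
  let α := hp.fundamentalGroupEquiv (x := q (p' e')) ⟨e, he⟩
  let β := hp'.fundamentalGroupEquiv (x := p' e') ⟨e', rfl⟩
  let φ := FundamentalGroup.map ⟨q, hq.continuous⟩ (p' e')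
  have hφ : Function.Injective φ := hq.injective_path_homotopic_map (p' e') (p' e')
  let ψ : Hᵐᵒᵖ →* Gᵐᵒᵖ := α.toMonoidHom.comp (φ.comp β.symm.toMonoidHom)
  have hψ : Function.Injective ψ := α.injective.comp (hφ.comp β.symm.injective)
  exact ⟨MonoidHom.unop ψ, MulOpposite.unop_injective.comp (hψ.comp MulOpposite.op_injective)⟩

/-- An open quotient by a closed equivalence relation is Hausdorff. -/
theorem IsOpenQuotientMap.t2Space_of_isClosed_ker {X Y : Type*} [TopologicalSpace X]
    [TopologicalSpace Y] {f : X → Y} (hf : IsOpenQuotientMap f)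
    (h : IsClosed {p : X × X | f p.1 = f p.2}) : T2Space Y := by
  rw [t2_iff_isClosed_diagonal, ← (hf.prodMap hf).isQuotientMap.isClosed_preimage]
  exact h

theorem IsLocalHomeomorph.of_comp_surjective {X Y Z : Type*} [TopologicalSpace X]
    [TopologicalSpace Y] [TopologicalSpace Z] {f : X → Y} {g : Y → Z}
    (hgf : IsLocalHomeomorph (g ∘ f)) (hf : IsLocalHomeomorph f) (hs : Function.Surjective f) :
    IsLocalHomeomorph g := by
  rw [isLocalHomeomorph_iff_isLocalHomeomorphOn_univ, ← hs.range_eq, ← Set.image_univ]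
  exact (hgf.isLocalHomeomorphOn).of_comp_right hf.isLocalHomeomorphOn

theorem IsLocalHomeomorph.isFiniteCovering {E X : Type*} [TopologicalSpace E] [TopologicalSpace X]
    [CompactSpace E] [T2Space E] [T2Space X] {p : E → X} (hp : IsLocalHomeomorph p)
    (hs : Function.Surjective p) : IsFiniteCovering p where
  isCoveringMap := isLocalHomeomorph_iff_isCoveringMap.1 hp
  surjective := hs
  finite_fiber x := by
    have hc : IsCompact (p ⁻¹' {x}) := (isClosed_singleton.preimage hp.continuous).isCompact
    have : DiscreteTopology (p ⁻¹' {x}) := (isLocalHomeomorph_iff_isCoveringMap.1 hp x).1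
    exact hc.finite (isDiscrete_iff_discreteTopology.2 this)

namespace MappingTorus

variable {X : Type*} [TopologicalSpace X] (f : X ≃ₜ X)

/-- The quotient map onto the mapping torus. -/
def mk (p : X × ℝ) : MappingTorus f := Quotient.mk (mappingTorusSetoid f) p

theorem isQuotientMap_mk : IsQuotientMap (mk f) := isQuotientMap_quotient_mk'

theorem mk_eq_mk_iff {p q : X × ℝ} : mk f p = mk f q ↔ ∃ n : ℤ, q = ((f ^ n) p.1, p.2 - n) :=
  Quotient.eq

/-- The graphs of the translations by different `n : ℤ` form a locally finite family, because `n` is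
the difference of the real coordinates. -/
theorem isClosed_ker_mk [T2Space X] :
    IsClosed {p : (X × ℝ) × (X × ℝ) | mk f p.1 = mk f p.2} := by
  have h : {p : (X × ℝ) × (X × ℝ) | mk f p.1 = mk f p.2} =
      ⋃ n : ℤ, {p : (X × ℝ) × (X × ℝ) | p.2 = ((f ^ n) p.1.1, p.1.2 - (n : ℝ))} := by
    ext p; simp only [Set.mem_ofPred_eq, mk_eq_mk_iff, Set.mem_iUnion]
  rw [h]
  refine LocallyFinite.isClosed_iUnion (fun x => ?_) fun n => isClosed_eq (by fun_prop) ?_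
  · refine ⟨{p | |(p.1.2 - p.2.2) - (x.1.2 - x.2.2)| < 1}, ?_, ?_⟩
    · refine IsOpen.mem_nhds (isOpen_lt (by fun_prop) (by fun_prop)) (by simp)
    · refine (Set.finite_Icc (⌊x.1.2 - x.2.2⌋ - 1) (⌈x.1.2 - x.2.2⌉ + 1)).subset ?_
      rintro n ⟨p, hp, hpx⟩
      have hp2 : p.2.2 = p.1.2 - n := congrArg Prod.snd hp
      simp only [Set.mem_ofPred_eq, hp2, abs_lt] at hpx
      have h1 := Int.floor_le (x.1.2 - x.2.2)
      have h2 := Int.le_ceil (x.1.2 - x.2.2)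
      refine ⟨?_, ?_⟩
      · rw [← @Int.cast_le ℝ]; push_cast; linarith
      · rw [← @Int.cast_le ℝ]; push_cast; linarith
  · have := (f ^ n).continuous
    fun_prop

instance [CompactSpace X] : CompactSpace (MappingTorus f) := by
  have h : mk f '' (Set.univ ×ˢ Set.Icc 0 1) = Set.univ := by
    refine Set.eq_univ_of_forall fun y => ?_
    obtain ⟨⟨x, t⟩, rfl⟩ := (isQuotientMap_mk f).surjective y
    refine ⟨((f ^ ⌊t⌋) x, t - ⌊t⌋), ⟨trivial, ?_, ?_⟩, ((mk_eq_mk_iff f (p := (x, t))).2 ⟨⌊t⌋, rfl⟩).symm⟩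
    · simp
    · have := Int.lt_floor_add_one t
      change t - ⌊t⌋ ≤ 1
      linarith
  refine ⟨?_⟩
  rw [← h]
  exact (isCompact_univ.prod isCompact_Icc).image (isQuotientMap_mk f).continuous

end MappingTorus

/-! ### Traces and intertwiners in `SL(2, ℤ)` -/

/-- The Cayley–Hamilton recursion for traces of powers. -/
theorem trace_pow_add_two (A : SpecialLinearGroup (Fin 2) ℤ) (k : ℕ) :
    (A ^ (k + 2)).1.trace = A.1.trace * (A ^ (k + 1)).1.trace - (A ^ k).1.trace := by
  have hd := A.2
  rw [det_fin_two] at hd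
  have h1 : (A ^ (k + 1)).1 = (A ^ k).1 * A.1 := by rw [pow_succ]; rfl
  have h2 : (A ^ (k + 2)).1 = (A ^ k).1 * A.1 * A.1 := by rw [pow_succ, pow_succ]; rfl
  rw [h1, h2]
  simp only [trace_fin_two, mul_apply, Fin.sum_univ_two]
  linear_combination ((A ^ k).1 0 0 + (A ^ k).1 1 1) * (-hd)

theorem strictMono_abs_trace_pow {A : SpecialLinearGroup (Fin 2) ℤ} (hA : 3 ≤ |A.1.trace|) :
    StrictMono fun k : ℕ => |(A ^ k).1.trace| := by
  refine strictMono_nat_of_lt_succ fun k => ?_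
  induction k with
  | zero => simp [trace_one]; omega
  | succ k ih =>
    rw [trace_pow_add_two]
    have h1 := abs_sub_abs_le_abs_sub (A.1.trace * (A ^ (k + 1)).1.trace) (A ^ k).1.trace
    rw [abs_mul] at h1
    nlinarith [abs_nonneg (A ^ (k + 1)).1.trace]

theorem trace_zpow (A : SpecialLinearGroup (Fin 2) ℤ) (n : ℤ) :
    (A ^ n).1.trace = (A ^ n.natAbs).1.trace := by
  obtain h | h := n.natAbs_eq
  · rw [h, zpow_natCast, Int.natAbs_natCast]
  · rw [h, _root_.zpow_neg, zpow_natCast, Int.natAbs_neg, Int.natAbs_natCast]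
    have hinv : ((A ^ n.natAbs)⁻¹).1 = (A ^ n.natAbs).1.adjugate := rfl
    rw [hinv, adjugate_fin_two, trace_fin_two, trace_fin_two]
    exact add_comm _ _

/-- Since `|tr Aᵏ|` is strictly increasing in `k`, two such matrices, each having the trace of a
power of the other, have the same trace. -/
theorem trace_eq_of_trace_eq_zpow {A B : SpecialLinearGroup (Fin 2) ℤ}
    (hA : 3 ≤ |A.1.trace|) (hB : 3 ≤ |B.1.trace|) {m n : ℤ}
    (hm : B.1.trace = (A ^ m).1.trace) (hn : A.1.trace = (B ^ n).1.trace) :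
    A.1.trace = B.1.trace := by
  have key : ∀ {A B : SpecialLinearGroup (Fin 2) ℤ}, 3 ≤ |A.1.trace| → 3 ≤ |B.1.trace| →
      ∀ {m : ℤ}, B.1.trace = (A ^ m).1.trace → |A.1.trace| ≤ |B.1.trace| := by
    intro A B hA hB m hm
    -- The exponent is nonzero because the identity has trace `2`.
    have := (strictMono_abs_trace_pow hA).monotone (a := 1) (b := m.natAbs) <| by
      rw [Nat.one_le_iff_ne_zero]
      intro h0
      rw [trace_zpow, h0] at hm
      simp [hm, trace_one] at hB
    simpa [hm, trace_zpow] using this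
  have heq : |(A ^ m.natAbs).1.trace| = |(A ^ 1).1.trace| := by
    rw [← trace_zpow, ← hm, pow_one]
    exact le_antisymm (key hB hA hn) (key hA hB hm)
  have h1 := (strictMono_abs_trace_pow hA).injective heq
  rw [hm, trace_zpow, h1, pow_one]

/-- Matrices in `SL(2, ℤ)` with the same trace, not `±2`, are conjugate over `ℚ`: both are conjugate
to the companion matrix of their characteristic polynomial, with `e₁` as a cyclic vector.
Clearing denominators gives an integer intertwiner. -/
theorem exists_intertwiner {A B : SpecialLinearGroup (Fin 2) ℤ} (hA : 3 ≤ |A.1.trace|)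
    (hB : 3 ≤ |B.1.trace|) (h : A.1.trace = B.1.trace) :
    ∃ P : Matrix (Fin 2) (Fin 2) ℤ, P.det ≠ 0 ∧ A.1 * P = P * B.1 := by
  -- A zero entry in the lower left corner would force both diagonal entries to be the same unit.
  have hc : ∀ {L : SpecialLinearGroup (Fin 2) ℤ}, 3 ≤ |L.1.trace| → L.1 1 0 ≠ 0 := by
    intro L hL h0
    have hd := L.2
    rw [det_fin_two, h0, mul_zero, sub_zero] at hd
    rw [trace_fin_two] at hL
    rcases Int.mul_eq_one_iff_eq_one_or_neg_one.1 hd with ⟨h1, h2⟩ | ⟨h1, h2⟩ <;>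
      simp [h1, h2] at hL
  -- The columns of the matrix are `e₁` and `L e₁`; it intertwines `L` and its companion matrix.
  have hK : ∀ L : SpecialLinearGroup (Fin 2) ℤ, L.1 * !![1, L.1 0 0; 0, L.1 1 0] =
      !![1, L.1 0 0; 0, L.1 1 0] * !![0, -1; 1, L.1.trace] := by
    intro L
    have hd := L.2
    rw [det_fin_two] at hd
    ext i j
    fin_cases i <;> fin_cases j <;> simp [mul_apply, Fin.sum_univ_two, trace_fin_two]
    · linear_combination -hd
    · ring
  set KA : Matrix (Fin 2) (Fin 2) ℤ := !![1, A.1 0 0; 0, A.1 1 0] with hKA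
  set KB : Matrix (Fin 2) (Fin 2) ℤ := !![1, B.1 0 0; 0, B.1 1 0] with hKB
  have hdA : KA.det ≠ 0 := by simpa [hKA, det_fin_two] using hc hA
  have hdB : KB.det ≠ 0 := by simpa [hKB, det_fin_two] using hc hB
  refine ⟨KA * KB.adjugate, ?_, ?_⟩
  · rw [det_mul, det_adjugate]
    exact mul_ne_zero hdA (pow_ne_zero _ hdB)
  · have h2 : !![0, -1; 1, B.1.trace] * KB.adjugate = KB.adjugate * B.1 := by
      have h3 : KB.adjugate * (B.1 * KB) * KB.adjugate =
          KB.adjugate * (KB * !![0, -1; 1, B.1.trace]) * KB.adjugate := by rw [hK B]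
      have h4 : KB.adjugate * (B.1 * KB) * KB.adjugate = KB.det • (KB.adjugate * B.1) := by
        rw [Matrix.mul_assoc, Matrix.mul_assoc, mul_adjugate, Matrix.mul_smul, Matrix.mul_smul,
          Matrix.mul_one]
      have h5 : KB.adjugate * (KB * !![0, -1; 1, B.1.trace]) * KB.adjugate =
          KB.det • (!![0, -1; 1, B.1.trace] * KB.adjugate) := by
        rw [← Matrix.mul_assoc, adjugate_mul, Matrix.smul_mul, Matrix.smul_mul, Matrix.one_mul]
      rw [h4, h5] at h3
      exact (smul_right_injective _ hdB h3).symm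
    rw [← Matrix.mul_assoc, hK A, h, Matrix.mul_assoc, h2, Matrix.mul_assoc]

theorem trace_eq_of_mul_eq {M N P : Matrix (Fin 2) (Fin 2) ℤ} (hP : P.det ≠ 0)
    (h : P * N = M * P) : N.trace = M.trace := by
  have h1 : (P * N * P.adjugate).trace = (M * P * P.adjugate).trace := by rw [h]
  rw [trace_mul_comm, ← Matrix.mul_assoc, adjugate_mul, Matrix.mul_assoc, mul_adjugate, Matrix.smul_mul,
    Matrix.one_mul, Matrix.mul_smul, Matrix.mul_one, trace_smul, trace_smul] at h1
  exact smul_right_injective _ hP h1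

/-! ### The group `ℤ² ⋊ ℤ` -/

/-- The semidirect product `ℤ² ⋊ ℤ` in which the generator of `ℤ` acts on `ℤ²` by `L`. It is the
fundamental group of the torus bundle with monodromy `L`. -/
@[ext]
structure TorusBundleGroup (L : SpecialLinearGroup (Fin 2) ℤ) where
  /-- The component in the normal subgroup `ℤ²`. -/
  fiber : Fin 2 → ℤ
  /-- The image in the quotient `ℤ`. -/
  base : ℤ

namespace TorusBundleGroup

variable {L : SpecialLinearGroup (Fin 2) ℤ}

instance : Mul (TorusBundleGroup L) :=
  ⟨fun g h => ⟨g.fiber + (L ^ g.base).1 *ᵥ h.fiber, g.base + h.base⟩⟩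

instance : One (TorusBundleGroup L) := ⟨⟨0, 0⟩⟩

instance : Inv (TorusBundleGroup L) :=
  ⟨fun g => ⟨-((L ^ (-g.base)).1 *ᵥ g.fiber), -g.base⟩⟩

@[simp] theorem fiber_mul (g h : TorusBundleGroup L) :
    (g * h).fiber = g.fiber + (L ^ g.base).1 *ᵥ h.fiber := rfl

@[simp] theorem base_mul (g h : TorusBundleGroup L) : (g * h).base = g.base + h.base := rfl

@[simp] theorem fiber_one : (1 : TorusBundleGroup L).fiber = 0 := rfl

@[simp] theorem base_one : (1 : TorusBundleGroup L).base = 0 := rfl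

@[simp] theorem fiber_inv (g : TorusBundleGroup L) :
    g⁻¹.fiber = -((L ^ (-g.base)).1 *ᵥ g.fiber) := rfl

@[simp] theorem base_inv (g : TorusBundleGroup L) : g⁻¹.base = -g.base := rfl

theorem coe_zpow_add (L : SpecialLinearGroup (Fin 2) ℤ) (m n : ℤ) :
    (L ^ (m + n)).1 = (L ^ m).1 * (L ^ n).1 := by rw [_root_.zpow_add]; rfl

instance : Group (TorusBundleGroup L) :=
  Group.ofLeftAxioms
    (fun g h k => by
      ext1
      · simp only [fiber_mul, base_mul, coe_zpow_add, mulVec_add, mulVec_mulVec, add_assoc]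
      · simp [add_assoc])
    (fun g => by ext1 <;> simp)
    (fun g => by ext1 <;> simp)

/-- The inclusion of the normal subgroup `ℤ²`. -/
def ofFiber (L : SpecialLinearGroup (Fin 2) ℤ) (v : Fin 2 → ℤ) : TorusBundleGroup L := ⟨v, 0⟩

/-- The generator of the factor `ℤ`, which acts on `ℤ²` by `L`. -/
def stable (L : SpecialLinearGroup (Fin 2) ℤ) : TorusBundleGroup L := ⟨0, 1⟩

theorem ofFiber_add (v w : Fin 2 → ℤ) : ofFiber L (v + w) = ofFiber L v * ofFiber L w := by
  ext1 <;> simp [ofFiber]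

theorem ofFiber_mulVec (v : Fin 2 → ℤ) :
    ofFiber L (L.1 *ᵥ v) = stable L * ofFiber L v * (stable L)⁻¹ := by
  ext1 <;> simp [ofFiber, stable]

/-- The subgroup `(L - 1) ℤ²` consists of commutators. -/
theorem ofFiber_mulVec_sub (v : Fin 2 → ℤ) :
    ofFiber L (L.1 *ᵥ v - v) = stable L * ofFiber L v * (stable L)⁻¹ * (ofFiber L v)⁻¹ := by
  rw [← ofFiber_mulVec]
  ext1 <;> simp [ofFiber, sub_eq_add_neg]

theorem conj_fiber (g h : TorusBundleGroup L) (hh : h.base = 0) :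
    (g * h * g⁻¹).fiber = (L ^ g.base).1 *ᵥ h.fiber := by
  simp only [fiber_mul, base_mul, fiber_inv, hh, add_zero, mulVec_neg, mulVec_mulVec,
    ← coe_zpow_add, add_neg_cancel, _root_.zpow_zero]
  have h1 : (1 : SpecialLinearGroup (Fin 2) ℤ).1 = 1 := rfl
  rw [h1, one_mulVec]
  abel

/-- An injective homomorphism `ℤ² ⋊_B ℤ → ℤ² ⋊_A ℤ` sends the lattice `(B - 1) ℤ²`, which consists
of commutators and has rank two, into the fiber subgroup `ℤ²`. On this lattice it intertwines the
conjugation by the stable letter, which is `B`, with the conjugation by its image, which is a power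
of `A`. -/
theorem exists_intertwiner_of_injective {A B : SpecialLinearGroup (Fin 2) ℤ}
    (hB : 3 ≤ |B.1.trace|) (ρ : TorusBundleGroup B →* TorusBundleGroup A)
    (hρ : Function.Injective ρ) :
    ∃ (n : ℤ) (P : Matrix (Fin 2) (Fin 2) ℤ), P.det ≠ 0 ∧ P * B.1 = (A ^ n).1 * P := by
  -- `det (B - 1) = 2 - tr B`.
  have hdet : (B.1 - 1).det ≠ 0 := by
    have hd := B.2
    rw [det_fin_two] at hd
    rw [trace_fin_two] at hB
    intro h0
    simp [det_fin_two] at h0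
    have : B.1 0 0 + B.1 1 1 = 2 := by linear_combination hd - h0
    simp [this] at hB
  -- The group `ℤ` of base components is abelian, so commutators have base component zero.
  have hbase : ∀ v, (ρ (ofFiber B (B.1 *ᵥ v - v))).base = 0 := fun v => by
    rw [ofFiber_mulVec_sub]; simp
  let F : (Fin 2 → ℤ) →+ (Fin 2 → ℤ) :=
    AddMonoidHom.mk' (fun v => (ρ (ofFiber B (B.1 *ᵥ v - v))).fiber) fun v w => by
      have : B.1 *ᵥ (v + w) - (v + w) = (B.1 *ᵥ v - v) + (B.1 *ᵥ w - w) := by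
        rw [mulVec_add]; abel
      rw [this, ofFiber_add, map_mul, fiber_mul, hbase]
      simp
  have hF : ∀ v, F v = (ρ (ofFiber B (B.1 *ᵥ v - v))).fiber := fun _ => rfl
  have hP : ∀ v, LinearMap.toMatrix' F.toIntLinearMap *ᵥ v = F v := fun v => by
    rw [LinearMap.toMatrix'_mulVec]; rfl
  refine ⟨(ρ (stable B)).base, LinearMap.toMatrix' F.toIntLinearMap, fun h0 => ?_, ?_⟩
  · obtain ⟨v, hv, hv0⟩ := exists_mulVec_eq_zero_iff.2 h0
    rw [hP, hF] at hv0
    have h1 : ofFiber B (B.1 *ᵥ v - v) = 1 :=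
      hρ ((TorusBundleGroup.ext hv0 (hbase v)).trans (map_one ρ).symm)
    exact hdet (exists_mulVec_eq_zero_iff.1 ⟨v, hv, by
      rw [sub_mulVec, one_mulVec]; exact congrArg fiber h1⟩)
  · refine ext_of_mulVec_single fun i => ?_
    rw [← mulVec_mulVec, ← mulVec_mulVec, hP, hP, hF, hF, ← mulVec_sub, ofFiber_mulVec, map_mul,
      map_mul, map_inv, conj_fiber _ _ (hbase _)]

end TorusBundleGroup

/-! ### Linear maps of the plane and of the torus -/

/-- `torusHomeo` as a group homomorphism. -/
def torusHomeoHom :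
    SpecialLinearGroup (Fin 2) ℤ →* (UnitAddTorus (Fin 2) ≃ₜ UnitAddTorus (Fin 2)) where
  toFun := torusHomeo
  map_one' := Homeomorph.ext torusMatrixMap_one
  map_mul' K L := Homeomorph.ext (torusMatrixMap_mul K.1 L.1)

theorem torusHomeo_zpow_apply (L : SpecialLinearGroup (Fin 2) ℤ) (n : ℤ)
    (x : UnitAddTorus (Fin 2)) : (torusHomeo L ^ n) x = torusMatrixMap (L ^ n).1 x :=
  congrArg (fun h : UnitAddTorus (Fin 2) ≃ₜ UnitAddTorus (Fin 2) => h x)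
    (map_zpow torusHomeoHom L n).symm

/-- The linear map of `ℝ²` given by an integer matrix. -/
def planeMap (P : Matrix (Fin 2) (Fin 2) ℤ) (x : Fin 2 → ℝ) : Fin 2 → ℝ :=
  P.map (Int.cast : ℤ → ℝ) *ᵥ x

theorem planeMap_one (x : Fin 2 → ℝ) : planeMap 1 x = x := by
  simp [planeMap, Matrix.map_one]

theorem planeMap_mul (P Q : Matrix (Fin 2) (Fin 2) ℤ) (x : Fin 2 → ℝ) :
    planeMap (P * Q) x = planeMap P (planeMap Q x) := by
  rw [planeMap, planeMap, planeMap, mulVec_mulVec]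
  congr 1
  exact Matrix.map_mul (f := Int.castRingHom ℝ)

theorem planeMap_add (P : Matrix (Fin 2) (Fin 2) ℤ) (x y : Fin 2 → ℝ) :
    planeMap P (x + y) = planeMap P x + planeMap P y := mulVec_add _ _ _

theorem planeMap_intCast (P : Matrix (Fin 2) (Fin 2) ℤ) (v : Fin 2 → ℤ) :
    planeMap P (fun i => (v i : ℝ)) = fun i => ((P *ᵥ v) i : ℝ) := by
  funext i
  simp [planeMap, mulVec, dotProduct, Fin.sum_univ_two]

theorem continuous_planeMap (P : Matrix (Fin 2) (Fin 2) ℤ) : Continuous (planeMap P) :=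
  continuous_const.matrix_mulVec continuous_id

/-- The linear homeomorphism of `ℝ²` given by an integer matrix with nonzero determinant. -/
noncomputable def planeHomeo (P : Matrix (Fin 2) (Fin 2) ℤ) (hP : P.det ≠ 0) :
    (Fin 2 → ℝ) ≃ₜ (Fin 2 → ℝ) where
  toFun := planeMap P
  invFun x := (P.map (Int.cast : ℤ → ℝ))⁻¹ *ᵥ x
  left_inv x := by
    have h : IsUnit (P.map (Int.cast : ℤ → ℝ)).det := by
      rw [← Int.cast_det]; exact isUnit_iff_ne_zero.2 (Int.cast_ne_zero.2 hP)
    simp only [planeMap, mulVec_mulVec, nonsing_inv_mul _ h, one_mulVec]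
  right_inv x := by
    have h : IsUnit (P.map (Int.cast : ℤ → ℝ)).det := by
      rw [← Int.cast_det]; exact isUnit_iff_ne_zero.2 (Int.cast_ne_zero.2 hP)
    simp only [planeMap, mulVec_mulVec, mul_nonsing_inv _ h, one_mulVec]
  continuous_toFun := continuous_planeMap P
  continuous_invFun := continuous_const.matrix_mulVec continuous_id

/-- The projection `ℝ² → ℝ² / ℤ²`. -/
def toTorus (x : Fin 2 → ℝ) : UnitAddTorus (Fin 2) := fun i => (x i : UnitAddCircle)

theorem toTorus_planeMap (P : Matrix (Fin 2) (Fin 2) ℤ) (x : Fin 2 → ℝ) :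
    toTorus (planeMap P x) = torusMatrixMap P (toTorus x) := by
  funext i
  simp [toTorus, planeMap, torusMatrixMap, mulVec, dotProduct, Fin.sum_univ_two,
    ← zsmul_eq_mul]

theorem toTorus_eq_iff {x y : Fin 2 → ℝ} :
    toTorus x = toTorus y ↔ ∃ v : Fin 2 → ℤ, x = (fun i => (v i : ℝ)) + y := by
  have h : ∀ i, toTorus x i = toTorus y i ↔ ∃ n : ℤ, x i = n + y i := fun i => by
    rw [toTorus, toTorus, ← sub_eq_zero, ← AddCircle.coe_sub, AddCircle.coe_eq_zero_iff]
    simp only [zsmul_eq_mul, mul_one, eq_sub_iff_add_eq, eq_comm (a := x i)]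
  rw [funext_iff]
  simp only [h, Classical.skolem, funext_iff, Pi.add_apply]

theorem isOpenQuotientMap_toTorus : IsOpenQuotientMap toTorus :=
  IsOpenQuotientMap.piMap fun _ => QuotientAddGroup.isOpenQuotientMap_mk

/-! ### The universal cover of a torus bundle -/

namespace TorusBundleGroup

variable {L : SpecialLinearGroup (Fin 2) ℤ}

/-- The action of the group of a torus bundle on `ℝ² × ℝ` by
`(v, n) • (x, t) = (v + Lⁿ x, t - n)`. -/
instance : MulAction (TorusBundleGroup L) ((Fin 2 → ℝ) × ℝ) where
  smul g p := ((fun i => (g.fiber i : ℝ)) + planeMap (L ^ g.base).1 p.1, p.2 - g.base)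
  one_smul p := by
    refine Prod.ext ?_ ?_
    · change (fun i => (((0 : Fin 2 → ℤ) i : ℤ) : ℝ)) + planeMap 1 p.1 = p.1
      rw [planeMap_one]
      funext i
      simp
    · change p.2 - ((0 : ℤ) : ℝ) = p.2
      simp
  mul_smul g h p := by
    refine Prod.ext ?_ ?_
    · change (fun i => (((g * h).fiber i : ℤ) : ℝ)) + planeMap (L ^ (g.base + h.base)).1 p.1 =
        (fun i => (g.fiber i : ℝ)) + planeMap (L ^ g.base).1
          ((fun i => (h.fiber i : ℝ)) + planeMap (L ^ h.base).1 p.1)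
      rw [coe_zpow_add, planeMap_mul, planeMap_add, planeMap_intCast, ← add_assoc]
      congr 1
      funext i
      simp only [fiber_mul, Pi.add_apply, Int.cast_add]
    · change p.2 - ((g.base + h.base : ℤ) : ℝ) = p.2 - h.base - g.base
      push_cast
      ring

theorem smul_def (g : TorusBundleGroup L) (p : (Fin 2 → ℝ) × ℝ) :
    g • p = ((fun i => (g.fiber i : ℝ)) + planeMap (L ^ g.base).1 p.1, p.2 - g.base) := rfl

end TorusBundleGroup

/-- The universal covering map `ℝ² × ℝ → M_L` of a torus bundle. -/
def torusBundleProj (L : SpecialLinearGroup (Fin 2) ℤ) (p : (Fin 2 → ℝ) × ℝ) : TorusBundle L :=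
  MappingTorus.mk (torusHomeo L) (toTorus p.1, p.2)

theorem torusBundleProj_eq_iff {L : SpecialLinearGroup (Fin 2) ℤ} {p q : (Fin 2 → ℝ) × ℝ} :
    torusBundleProj L p = torusBundleProj L q ↔ p ∈ MulAction.orbit (TorusBundleGroup L) q := by
  refine eq_comm.trans ((MappingTorus.mk_eq_mk_iff (torusHomeo L)).trans ?_)
  simp only [torusHomeo_zpow_apply, ← toTorus_planeMap, Prod.mk.injEq, toTorus_eq_iff,
    MulAction.mem_orbit_iff, TorusBundleGroup.smul_def]
  constructor
  · rintro ⟨n, ⟨v, hv⟩, ht⟩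
    exact ⟨⟨v, n⟩, Prod.ext hv.symm ht.symm⟩
  · rintro ⟨g, rfl⟩
    exact ⟨g.base, ⟨g.fiber, rfl⟩, rfl⟩

theorem Int.eq_zero_of_abs_cast_real_lt_one {n : ℤ} (h : |(n : ℝ)| < 1) : n = 0 :=
  Int.abs_lt_one_iff.1 (by exact_mod_cast h)

theorem isQuotientCoveringMap_torusBundleProj (L : SpecialLinearGroup (Fin 2) ℤ) :
    IsQuotientCoveringMap (torusBundleProj L) (TorusBundleGroup L) where
  toIsQuotientMap := (MappingTorus.isQuotientMap_mk (torusHomeo L)).comp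
    (isOpenQuotientMap_toTorus.prodMap IsOpenQuotientMap.id).isQuotientMap
  continuous_const_smul g := by
    have := continuous_planeMap (L ^ g.base).1
    simp only [TorusBundleGroup.smul_def]
    fun_prop
  apply_eq_iff_mem_orbit := torusBundleProj_eq_iff
  disjoint e := by
    -- A translate of `p` at distance less than `1` from `p` has the same real coordinate, and then
    -- its plane coordinate differs from that of `p` by an integer vector.
    refine ⟨Metric.ball e (1 / 2), Metric.ball_mem_nhds e (by norm_num), ?_⟩
    rintro g ⟨_, ⟨p, hp, rfl⟩, hgp⟩
    have hd : dist (g • p) p < 1 := by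
      have := dist_triangle_right (g • p) p e
      rw [Metric.mem_ball] at hp hgp
      linarith
    rw [Prod.dist_eq, max_lt_iff, TorusBundleGroup.smul_def] at hd
    have hbase : g.base = 0 := Int.eq_zero_of_abs_cast_real_lt_one <| by
      simpa [Real.dist_eq] using hd.2
    refine TorusBundleGroup.ext (funext fun i => Int.eq_zero_of_abs_cast_real_lt_one ?_) hbase
    have h1 := (dist_le_pi_dist _ _ i).trans_lt hd.1
    have hone : (L ^ (0 : ℤ)).1 = 1 := rfl
    rw [hbase, hone, planeMap_one] at h1
    simpa [Real.dist_eq] using h1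

instance (L : SpecialLinearGroup (Fin 2) ℤ) : CompactSpace (TorusBundle L) :=
  inferInstanceAs (CompactSpace (MappingTorus (torusHomeo L)))

instance (L : SpecialLinearGroup (Fin 2) ℤ) : T2Space (TorusBundle L) := by
  have h : IsOpenQuotientMap (MappingTorus.mk (torusHomeo L)) :=
    ((isOpenQuotientMap_toTorus.prodMap IsOpenQuotientMap.id).of_comp_iff).1
      (isQuotientCoveringMap_torusBundleProj L).isOpenQuotientMap
  exact h.t2Space_of_isClosed_ker (MappingTorus.isClosed_ker_mk _)

/-! ### Finite coverings between torus bundles -/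

theorem zpow_mul_intertwiner {A B : SpecialLinearGroup (Fin 2) ℤ} {P : Matrix (Fin 2) (Fin 2) ℤ}
    (h : A.1 * P = P * B.1) (n : ℤ) : (A ^ n).1 * P = P * (B ^ n).1 := by
  have hA (L : SpecialLinearGroup (Fin 2) ℤ) :
      (L ^ n).1 = ((SpecialLinearGroup.toGL L ^ n : GL (Fin 2) ℤ) : Matrix _ _ ℤ) := by
    rw [← map_zpow]; rfl
  have hs : SemiconjBy P ((SpecialLinearGroup.toGL B : GL (Fin 2) ℤ) : Matrix _ _ ℤ)
      ((SpecialLinearGroup.toGL A : GL (Fin 2) ℤ) : Matrix _ _ ℤ) := h.symm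
  rw [hA, hA]
  exact (hs.units_zpow_right n).eq.symm

/-- The covering map is induced by `(x, t) ↦ (P x, t)`. Its lift to `ℝ² × ℝ` is a homeomorphism, so
it is a local homeomorphism, and local homeomorphisms between compact Hausdorff spaces are
covering maps. -/
theorem exists_isFiniteCovering {A B : SpecialLinearGroup (Fin 2) ℤ}
    {P : Matrix (Fin 2) (Fin 2) ℤ} (hP : P.det ≠ 0) (h : A.1 * P = P * B.1) :
    ∃ p : TorusBundle B → TorusBundle A, IsFiniteCovering p := by
  have hlift : ∀ a b, mappingTorusSetoid (torusHomeo B) a b →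
      MappingTorus.mk (torusHomeo A) (torusMatrixMap P a.1, a.2) =
        MappingTorus.mk (torusHomeo A) (torusMatrixMap P b.1, b.2) := by
    rintro a _ ⟨n, rfl⟩
    refine (MappingTorus.mk_eq_mk_iff _).2 ⟨n, ?_⟩
    simp only [torusHomeo_zpow_apply, ← torusMatrixMap_mul, zpow_mul_intertwiner h n]
  let p : TorusBundle B → TorusBundle A := Quotient.lift _ hlift
  let Φ : (Fin 2 → ℝ) × ℝ ≃ₜ (Fin 2 → ℝ) × ℝ := (planeHomeo P hP).prodCongr (.refl ℝ)
  have hcomp : p ∘ torusBundleProj B = torusBundleProj A ∘ Φ := by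
    funext x
    change MappingTorus.mk _ (torusMatrixMap P (toTorus x.1), x.2) =
      MappingTorus.mk _ (toTorus (planeMap P x.1), x.2)
    rw [toTorus_planeMap]
  have hA := isQuotientCoveringMap_torusBundleProj A
  have hB := isQuotientCoveringMap_torusBundleProj B
  refine ⟨p, IsLocalHomeomorph.isFiniteCovering ?_ ?_⟩
  · refine IsLocalHomeomorph.of_comp_surjective ?_ hB.isCoveringMap.isLocalHomeomorph hB.surjective
    rw [hcomp]
    exact hA.isCoveringMap.isLocalHomeomorph.comp Φ.isLocalHomeomorph
  · refine Function.Surjective.of_comp (g := torusBundleProj B) ?_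
    rw [hcomp]
    exact hA.surjective.comp Φ.surjective

/-- If `M_B` covers `M_A`, then `B` has the trace of some power of `A`. -/
theorem exists_trace_eq_zpow {A B : SpecialLinearGroup (Fin 2) ℤ} (hB : 3 ≤ |B.1.trace|)
    (h : HasFiniteCoverHomeomorphicTo (TorusBundle A) (TorusBundle B)) :
    ∃ n : ℤ, B.1.trace = (A ^ n).1.trace := by
  obtain ⟨E, _, p, hp, ⟨e⟩⟩ := h
  obtain ⟨ρ, hρ⟩ := (isQuotientCoveringMap_torusBundleProj A).exists_injective_monoidHom
    (isQuotientCoveringMap_torusBundleProj B) (hp.isCoveringMap.comp_homeomorph e.symm)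
  obtain ⟨n, P, hP, hPB⟩ := TorusBundleGroup.exists_intertwiner_of_injective hB ρ hρ
  exact ⟨n, trace_eq_of_mul_eq hP hPB⟩

theorem hasFiniteCover_of_trace_eq {A B : SpecialLinearGroup (Fin 2) ℤ} (hA : 3 ≤ |A.1.trace|)
    (hB : 3 ≤ |B.1.trace|) (h : A.1.trace = B.1.trace) :
    HasFiniteCoverHomeomorphicTo (TorusBundle A) (TorusBundle B) := by
  obtain ⟨P, hP, hAB⟩ := exists_intertwiner hA hB h
  obtain ⟨p, hp⟩ := exists_isFiniteCovering hP hAB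
  exact ⟨TorusBundle B, inferInstance, p, hp, ⟨.refl _⟩⟩

theorem theorem7p2 (A B : Matrix.SpecialLinearGroup (Fin 2) ℤ)
    (hA : 3 ≤ |A.1.trace|) (hB : 3 ≤ |B.1.trace|) :
    (HasFiniteCoverHomeomorphicTo (TorusBundle A) (TorusBundle B) ∧
      HasFiniteCoverHomeomorphicTo (TorusBundle B) (TorusBundle A)) ↔
    A.1.trace = B.1.trace := by
  constructor
  · rintro ⟨h1, h2⟩
    obtain ⟨m, hm⟩ := exists_trace_eq_zpow hB h1
    obtain ⟨n, hn⟩ := exists_trace_eq_zpow hA h2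
    exact trace_eq_of_trace_eq_zpow hA hB hm hn
  · exact fun h => ⟨hasFiniteCover_of_trace_eq hA hB h, hasFiniteCover_of_trace_eq hB hA h.symm⟩
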